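/- All spaces are complex Banach spaces. $\mathcal F(E,F)$ is the space of bounded finite-rank operators $E\to F$, $\mathcal F(E)=\mathcal F(E,E)$, and $\mathcal A(X)$ is the closure of $\mathcal F(X)$ in the operator norm. An *operator ideal norm* on $\mathcal F$ is a function $\gamma$ assigning to every finite-rank operator between Banach spaces a number in $[0,\infty)$ such that (a) $\gamma$ is a norm on each $\mathcal F(E,F)$, (b) $\gamma(I_{\mathbb C})=1$, and (c) $\gamma(ATB)\le\|A\|\,\gamma(T)\,\|B\|$ for $T\in\mathcal F(E,F)$ and bounded $A:F\to F_0$, $B:E_0\to E$. A Banach algebra $\mathcal A$ is *$K$-amenable* if there is a net $(d_\alpha)$ in the projective tensor product $\mathcal A\widehat\otimes\mathcal A$ with $\|d_\alpha\|\le K$ for all $\alpha$ such that $\pi(d_\alpha)a\to a$ and $a\cdot d_\alpha-d_\alpha\cdot a\to0$ for all $a\in\mathcal A$, where $\pi(a\otimes b)=ab$, $a\cdot(b\otimes c)=ab\otimes c$ and $(b\otimes c)\cdot a=b\otimes ca$. Let $X$ be a Banach space such that $\mathcal A(X)$ is $K$-amenable, let $P:X\to X$ be a bounded projection with $P\ne0$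 and $P\ne I$, and set $Y=\operatorname{rg}P$, $Z=\operatorname{rg}(I-P)$. Then there is a number $$0<\kappa\le 4K^2\,\|P\|\,\|I-P\|\,\max\{\|P\|^4,\|I-P\|^4\}$$ such that for all operator ideal norms $\gamma,\tau$ on $\mathcal F$ and all constants $c,C>0$: if $c\gamma\le\tau\le C\gamma$ on $\mathcal F(Y,Z)$ or on $\mathcal F(Z,Y)$, then $$c\,\kappa^{-2}\gamma\le\tau\le C\,\kappa^{2}\gamma$$ on $\mathcal F(Y)$ or on $\mathcal F(Z)$. -/

import Mathlib

open scoped TensorProduct Topology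

universe u

set_option linter.unusedSectionVars false

noncomputable section

namespace OperatorIdeals

/-! ### Finite-rank and approximable operators -/

section Operators

/-- `𝓕(E, F)`: the space of bounded finite-rank operators from `E` to `F`. -/
def finiteRank (E F : Type u) [NormedAddCommGroup E] [NormedSpace ℂ E]
    [NormedAddCommGroup F] [NormedSpace ℂ F] : Submodule ℂ (E →L[ℂ] F) where
  carrier := {T | FiniteDimensional ℂ (LinearMap.range (T : E →ₗ[ℂ] F))}
  zero_mem' := by
    have h : LinearMap.range ((0 : E →L[ℂ] F) : E →ₗ[ℂ] F) = ⊥ := by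
      simp
    change FiniteDimensional ℂ (LinearMap.range ((0 : E →L[ℂ] F) : E →ₗ[ℂ] F))
    rw [h]
    infer_instance
  add_mem' := by
    intro S T hS hT
    have hS' : FiniteDimensional ℂ (LinearMap.range (S : E →ₗ[ℂ] F)) := hS
    have hT' : FiniteDimensional ℂ (LinearMap.range (T : E →ₗ[ℂ] F)) := hT
    refine Submodule.finiteDimensional_of_le
      (S₂ := LinearMap.range (S : E →ₗ[ℂ] F) ⊔ LinearMap.range (T : E →ₗ[ℂ] F)) ?_
    rintro _ ⟨x, rfl⟩
    exact Submodule.add_mem_sup ⟨x, rfl⟩ ⟨x, rfl⟩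
  smul_mem' := by
    intro a T hT
    have hT' : FiniteDimensional ℂ (LinearMap.range (T : E →ₗ[ℂ] F)) := hT
    refine Submodule.finiteDimensional_of_le (S₂ := LinearMap.range (T : E →ₗ[ℂ] F)) ?_
    rintro _ ⟨x, rfl⟩
    exact ⟨a • x, by simp⟩

theorem mem_finiteRank {E F : Type u} [NormedAddCommGroup E] [NormedSpace ℂ E]
    [NormedAddCommGroup F] [NormedSpace ℂ F] {T : E →L[ℂ] F} :
    T ∈ finiteRank E F ↔ FiniteDimensional ℂ (LinearMap.range (T : E →ₗ[ℂ] F)) :=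
  Iff.rfl

/-- `A ∘ T ∘ B` has finite rank whenever `T` has. -/
theorem comp_comp_mem_finiteRank {E₀ E F F₀ : Type u}
    [NormedAddCommGroup E₀] [NormedSpace ℂ E₀] [NormedAddCommGroup E] [NormedSpace ℂ E]
    [NormedAddCommGroup F] [NormedSpace ℂ F] [NormedAddCommGroup F₀] [NormedSpace ℂ F₀]
    (A : F →L[ℂ] F₀) {T : E →L[ℂ] F} (hT : T ∈ finiteRank E F) (B : E₀ →L[ℂ] E) :
    (A.comp T).comp B ∈ finiteRank E₀ F₀ := by
  have hT' : FiniteDimensional ℂ (LinearMap.range (T : E →ₗ[ℂ] F)) := hT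
  rw [mem_finiteRank]
  refine Submodule.finiteDimensional_of_le
    (S₂ := (LinearMap.range (T : E →ₗ[ℂ] F)).map (A : F →ₗ[ℂ] F₀)) ?_
  rintro _ ⟨x, rfl⟩
  exact ⟨T (B x), ⟨B x, rfl⟩, rfl⟩

/-- `A T B` as an element of `𝓕(E₀, F₀)`, for `T ∈ 𝓕(E, F)`. -/
def finiteRank.sandwich {E₀ E F F₀ : Type u}
    [NormedAddCommGroup E₀] [NormedSpace ℂ E₀] [NormedAddCommGroup E] [NormedSpace ℂ E]
    [NormedAddCommGroup F] [NormedSpace ℂ F] [NormedAddCommGroup F₀] [NormedSpace ℂ F₀]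
    (A : F →L[ℂ] F₀) (T : finiteRank E F) (B : E₀ →L[ℂ] E) : finiteRank E₀ F₀ :=
  ⟨(A.comp (T : E →L[ℂ] F)).comp B, comp_comp_mem_finiteRank A T.2 B⟩

/-- The identity of the one-dimensional space `ℂ` (lifted to the ambient universe). -/
def finiteRank.idScalar : finiteRank (ULift.{u} ℂ) (ULift.{u} ℂ) :=
  ⟨ContinuousLinearMap.id ℂ (ULift.{u} ℂ), by
    rw [mem_finiteRank]
    have : FiniteDimensional ℂ (ULift.{u} ℂ) := inferInstance
    infer_instance⟩

/-- The algebra `𝓕(X)` of finite-rank operators on `X`. -/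
def finiteRankAlgebra (X : Type u) [NormedAddCommGroup X] [NormedSpace ℂ X] :
    NonUnitalSubalgebra ℂ (X →L[ℂ] X) :=
  { finiteRank X X with
    mul_mem' := by
      intro S T hS hT
      exact comp_comp_mem_finiteRank (ContinuousLinearMap.id ℂ X) hS T }

/-- `𝓐(X)`: the algebra of approximable operators on `X`, that is, the closure of the
finite-rank operators in the operator norm. -/
def approximable (X : Type u) [NormedAddCommGroup X] [NormedSpace ℂ X] :
    NonUnitalSubalgebra ℂ (X →L[ℂ] X) :=
  (finiteRankAlgebra X).topologicalClosure

/-- `rg T`: the range of a bounded operator `T`. -/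
abbrev rg {X : Type u} [NormedAddCommGroup X] [NormedSpace ℂ X] (T : X →L[ℂ] X) :
    Submodule ℂ X :=
  LinearMap.range (T : X →ₗ[ℂ] X)

/-- The range of a bounded projection on a Banach space is a Banach space. -/
theorem completeSpace_range {X : Type u} [NormedAddCommGroup X] [NormedSpace ℂ X]
    [CompleteSpace X] {P : X →L[ℂ] X} (hP : IsIdempotentElem P) :
    CompleteSpace (rg P) := by
  have h : (rg P : Set X) = {x | P x = x} := by
    ext x
    constructor
    · rintro ⟨y, rfl⟩
      exact DFunLike.congr_fun hP.eq y
    · intro hx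
      exact ⟨x, hx⟩
  have hc : IsClosed (rg P : Set X) := by
    rw [h]
    exact isClosed_eq P.continuous continuous_id
  exact hc.completeSpace_coe

end Operators

/-! ### Operator ideal norms -/

/-- An operator ideal norm on the ideal `𝓕` of finite-rank operators between complex Banach
spaces. -/
structure OperatorIdealNorm where
  /-- The value of the norm at a finite-rank operator. -/
  toFun : ∀ {E F : Type u} [NormedAddCommGroup E] [NormedSpace ℂ E] [CompleteSpace E]
    [NormedAddCommGroup F] [NormedSpace ℂ F] [CompleteSpace F], finiteRank E F → ℝ
  nonneg : ∀ {E F : Type u} [NormedAddCommGroup E] [NormedSpace ℂ E] [CompleteSpace E]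
    [NormedAddCommGroup F] [NormedSpace ℂ F] [CompleteSpace F] (T : finiteRank E F),
    0 ≤ toFun T
  eq_zero_of_eq_zero : ∀ {E F : Type u} [NormedAddCommGroup E] [NormedSpace ℂ E]
    [CompleteSpace E] [NormedAddCommGroup F] [NormedSpace ℂ F] [CompleteSpace F]
    (T : finiteRank E F), toFun T = 0 → T = 0
  add_le : ∀ {E F : Type u} [NormedAddCommGroup E] [NormedSpace ℂ E] [CompleteSpace E]
    [NormedAddCommGroup F] [NormedSpace ℂ F] [CompleteSpace F] (S T : finiteRank E F),
    toFun (S + T) ≤ toFun S + toFun T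
  map_smul : ∀ {E F : Type u} [NormedAddCommGroup E] [NormedSpace ℂ E] [CompleteSpace E]
    [NormedAddCommGroup F] [NormedSpace ℂ F] [CompleteSpace F] (a : ℂ) (T : finiteRank E F),
    toFun (a • T) = ‖a‖ * toFun T
  map_idScalar : toFun finiteRank.idScalar = 1
  ideal : ∀ {E₀ E F F₀ : Type u} [NormedAddCommGroup E₀] [NormedSpace ℂ E₀] [CompleteSpace E₀]
    [NormedAddCommGroup E] [NormedSpace ℂ E] [CompleteSpace E]
    [NormedAddCommGroup F] [NormedSpace ℂ F] [CompleteSpace F]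
    [NormedAddCommGroup F₀] [NormedSpace ℂ F₀] [CompleteSpace F₀]
    (A : F →L[ℂ] F₀) (T : finiteRank E F) (B : E₀ →L[ℂ] E),
    toFun (finiteRank.sandwich A T B) ≤ ‖A‖ * toFun T * ‖B‖

/-- `c γ ≤ τ ≤ C γ` on `𝓕(E, F)`. -/
def NormBounds (γ τ : OperatorIdealNorm.{u}) (c C : ℝ) (E F : Type u)
    [NormedAddCommGroup E] [NormedSpace ℂ E] [CompleteSpace E]
    [NormedAddCommGroup F] [NormedSpace ℂ F] [CompleteSpace F] : Prop :=
  ∀ T : finiteRank E F, c * γ.toFun T ≤ τ.toFun T ∧ τ.toFun T ≤ C * γ.toFun T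

/-! ### The projective tensor product -/

section Projective

variable {E F : Type u} [NormedAddCommGroup E] [NormedSpace ℂ E]
  [NormedAddCommGroup F] [NormedSpace ℂ F]

/-- The tensor `∑ xᵢ ⊗ yᵢ` given by a finite list of pairs `(xᵢ, yᵢ)`. -/
def repSum (l : List (E × F)) : E ⊗[ℂ] F := (l.map fun p => p.1 ⊗ₜ[ℂ] p.2).sum

/-- The number `∑ ‖xᵢ‖ ‖yᵢ‖` given by a finite list of pairs `(xᵢ, yᵢ)`. -/
def repCost (l : List (E × F)) : ℝ := (l.map fun p => ‖p.1‖ * ‖p.2‖).sum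

/-- The projective norm on the algebraic tensor product: the infimum of `∑ ‖xᵢ‖ ‖yᵢ‖` over all
representations `∑ xᵢ ⊗ yᵢ` of the tensor. -/
def projNorm (x : E ⊗[ℂ] F) : ℝ := sInf (repCost '' {l : List (E × F) | repSum l = x})

theorem repCost_nonneg (l : List (E × F)) : 0 ≤ repCost l := by
  unfold repCost
  refine List.sum_nonneg ?_
  intro r hr
  obtain ⟨p, -, rfl⟩ := List.mem_map.1 hr
  positivity

theorem repSum_append (l m : List (E × F)) : repSum (l ++ m) = repSum l + repSum m := by
  simp [repSum]

theorem repCost_append (l m : List (E × F)) : repCost (l ++ m) = repCost l + repCost m := by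
  simp [repCost]

theorem exists_repSum (x : E ⊗[ℂ] F) : ∃ l : List (E × F), repSum l = x := by
  induction x using TensorProduct.induction_on with
  | zero => exact ⟨[], by simp [repSum]⟩
  | tmul a b => exact ⟨[(a, b)], by simp [repSum]⟩
  | add x y hx hy =>
    obtain ⟨l, rfl⟩ := hx
    obtain ⟨m, rfl⟩ := hy
    exact ⟨l ++ m, repSum_append l m⟩

theorem projNorm_le (l : List (E × F)) : projNorm (repSum l) ≤ repCost l := by
  refine csInf_le ⟨0, ?_⟩ ⟨l, rfl, rfl⟩
  rintro _ ⟨m, -, rfl⟩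
  exact repCost_nonneg m

theorem le_projNorm {x : E ⊗[ℂ] F} {r : ℝ}
    (h : ∀ l : List (E × F), repSum l = x → r ≤ repCost l) : r ≤ projNorm x := by
  obtain ⟨l, hl⟩ := exists_repSum x
  refine le_csInf ⟨_, l, hl, rfl⟩ ?_
  rintro _ ⟨m, hm, rfl⟩
  exact h m hm

theorem projNorm_nonneg (x : E ⊗[ℂ] F) : 0 ≤ projNorm x :=
  le_projNorm fun l _ => repCost_nonneg l

theorem projNorm_zero : projNorm (0 : E ⊗[ℂ] F) = 0 := by
  refine le_antisymm ?_ (projNorm_nonneg _)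
  simpa [repSum, repCost] using projNorm_le ([] : List (E × F))

theorem projNorm_add_le (x y : E ⊗[ℂ] F) : projNorm (x + y) ≤ projNorm x + projNorm y := by
  have h1 : projNorm (x + y) - projNorm y ≤ projNorm x := by
    refine le_projNorm fun l hl => ?_
    have h2 : projNorm (x + y) - repCost l ≤ projNorm y := by
      refine le_projNorm fun m hm => ?_
      have h3 := projNorm_le (l ++ m)
      rw [repSum_append, repCost_append, hl, hm] at h3
      linarith
    linarith
  linarith

/-- A subadditive functional on `E ⊗ F` is bounded by the projective norm as soon as it is so on
elementary tensors. -/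
theorem le_mul_projNorm {N : E ⊗[ℂ] F → ℝ} (hN0 : N 0 ≤ 0)
    (hN : ∀ x y, N (x + y) ≤ N x + N y) {C : ℝ} (hC : 0 ≤ C)
    (h : ∀ a b, N (a ⊗ₜ[ℂ] b) ≤ C * (‖a‖ * ‖b‖)) (x : E ⊗[ℂ] F) : N x ≤ C * projNorm x := by
  have key : ∀ l : List (E × F), N (repSum l) ≤ C * repCost l := by
    intro l
    induction l with
    | nil => simpa [repSum, repCost] using hN0
    | cons p l ih =>
      have h1 := hN (p.1 ⊗ₜ[ℂ] p.2) (repSum l)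
      have h2 := h p.1 p.2
      have h3 : repSum (p :: l) = p.1 ⊗ₜ[ℂ] p.2 + repSum l := by simp [repSum]
      have h4 : repCost (p :: l) = ‖p.1‖ * ‖p.2‖ + repCost l := by simp [repCost]
      rw [h3, h4, mul_add]
      linarith
  rcases hC.eq_or_lt with rfl | hC'
  · obtain ⟨l, rfl⟩ := exists_repSum x
    simpa using key l
  · have : N x / C ≤ projNorm x := by
      refine le_projNorm fun l hl => ?_
      rw [div_le_iff₀' hC', ← hl]
      exact key l
    rwa [div_le_iff₀' hC'] at this

theorem projNorm_smul_le (a : ℂ) (x : E ⊗[ℂ] F) : projNorm (a • x) ≤ ‖a‖ * projNorm x := by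
  refine le_mul_projNorm (N := fun x => projNorm (a • x)) ?_ ?_ (norm_nonneg a) ?_ x
  · simp [projNorm_zero]
  · intro x y
    rw [smul_add]
    exact projNorm_add_le _ _
  · intro b c
    have h := projNorm_le [(a • b, c)]
    simp only [repSum, repCost, List.map_cons, List.map_nil, List.sum_cons, List.sum_nil,
      add_zero] at h
    rwa [norm_smul, mul_assoc, ← TensorProduct.smul_tmul'] at h

/-- The projective norm as a seminorm. -/
def projSeminorm (E F : Type u) [NormedAddCommGroup E] [NormedSpace ℂ E]
    [NormedAddCommGroup F] [NormedSpace ℂ F] : Seminorm ℂ (E ⊗[ℂ] F) :=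
  Seminorm.ofSMulLE projNorm projNorm_zero projNorm_add_le projNorm_smul_le

/-- The algebraic tensor product `E ⊗ F`, to be given the projective norm. -/
def AlgTensor (E F : Type u) [NormedAddCommGroup E] [NormedSpace ℂ E]
    [NormedAddCommGroup F] [NormedSpace ℂ F] : Type u := E ⊗[ℂ] F

instance : AddCommGroup (AlgTensor E F) := inferInstanceAs (AddCommGroup (E ⊗[ℂ] F))

instance : Module ℂ (AlgTensor E F) := inferInstanceAs (Module ℂ (E ⊗[ℂ] F))

/-- The identity map from `E ⊗ F` to its copy carrying the projective norm. -/
def AlgTensor.of (E F : Type u) [NormedAddCommGroup E] [NormedSpace ℂ E]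
    [NormedAddCommGroup F] [NormedSpace ℂ F] : E ⊗[ℂ] F ≃ₗ[ℂ] AlgTensor E F :=
  LinearEquiv.refl ℂ (E ⊗[ℂ] F)

instance : SeminormedAddCommGroup (AlgTensor E F) :=
  fast_instance% AddGroupSeminorm.toSeminormedAddCommGroup
    ((projSeminorm E F).comp (AlgTensor.of E F).symm.toLinearMap).toAddGroupSeminorm

theorem AlgTensor.norm_of (x : E ⊗[ℂ] F) : ‖AlgTensor.of E F x‖ = projNorm x := rfl

theorem AlgTensor.norm_def (x : AlgTensor E F) :
    ‖x‖ = projNorm ((AlgTensor.of E F).symm x) := rfl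

instance : NormedSpace ℂ (AlgTensor E F) where
  norm_smul_le a x := by
    rw [AlgTensor.norm_def, AlgTensor.norm_def, map_smul]
    exact projNorm_smul_le a _

/-- The projective tensor product `E ⊗̂ F`: the completion of `E ⊗ F` for the projective norm. -/
abbrev ProjTensor (E F : Type u) [NormedAddCommGroup E] [NormedSpace ℂ E]
    [NormedAddCommGroup F] [NormedSpace ℂ F] : Type u :=
  UniformSpace.Completion (AlgTensor E F)

end Projective

/-! ### Amenable Banach algebras -/

section Amenable

variable {A : Type u} [NonUnitalNormedRing A] [NormedSpace ℂ A] [IsScalarTower ℂ A A]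
  [SMulCommClass ℂ A A]

theorem norm_mul'_le (x : AlgTensor A A) :
    ‖(LinearMap.mul' ℂ A ∘ₗ (AlgTensor.of A A).symm.toLinearMap) x‖ ≤ 1 * ‖x‖ := by
  rw [AlgTensor.norm_def, LinearMap.comp_apply, LinearEquiv.coe_coe]
  refine le_mul_projNorm (N := fun x : A ⊗[ℂ] A => ‖LinearMap.mul' ℂ A x‖) ?_ ?_
    zero_le_one ?_ ((AlgTensor.of A A).symm x)
  · simp
  · intro x y
    simpa using norm_add_le (LinearMap.mul' ℂ A x) (LinearMap.mul' ℂ A y)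
  · intro a b
    simpa using norm_mul_le a b

theorem norm_map_le (f g : A →ₗ[ℂ] A) {C : ℝ} (hC : 0 ≤ C)
    (h : ∀ b c, ‖f b‖ * ‖g c‖ ≤ C * (‖b‖ * ‖c‖)) (x : AlgTensor A A) :
    ‖((AlgTensor.of A A).toLinearMap ∘ₗ TensorProduct.map f g ∘ₗ
      (AlgTensor.of A A).symm.toLinearMap) x‖ ≤ C * ‖x‖ := by
  rw [AlgTensor.norm_def x, LinearMap.comp_apply, LinearMap.comp_apply, LinearEquiv.coe_coe,
    LinearEquiv.coe_coe, AlgTensor.norm_of]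
  refine le_mul_projNorm (N := fun x : A ⊗[ℂ] A => projNorm (TensorProduct.map f g x)) ?_ ?_
    hC ?_ ((AlgTensor.of A A).symm x)
  · simp [projNorm_zero]
  · intro x y
    rw [map_add]
    exact projNorm_add_le _ _
  · intro b c
    have h' := projNorm_le [(f b, g c)]
    simp only [repSum, repCost, List.map_cons, List.map_nil, List.sum_cons, List.sum_nil,
      add_zero] at h'
    exact h'.trans (h b c)

/-- The product map `A ⊗ A → A`, `a ⊗ b ↦ a b`, on the algebraic tensor product. -/
def algProduct (A : Type u) [NonUnitalNormedRing A] [NormedSpace ℂ A] [IsScalarTower ℂ A A]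
    [SMulCommClass ℂ A A] : AlgTensor A A →L[ℂ] A :=
  LinearMap.mkContinuous (LinearMap.mul' ℂ A ∘ₗ (AlgTensor.of A A).symm.toLinearMap) 1
    norm_mul'_le

/-- The map `b ⊗ c ↦ a b ⊗ c` on the algebraic tensor product. -/
def algLeft (a : A) : AlgTensor A A →L[ℂ] AlgTensor A A :=
  LinearMap.mkContinuous ((AlgTensor.of A A).toLinearMap ∘ₗ
    TensorProduct.map (LinearMap.mulLeft ℂ a) LinearMap.id ∘ₗ
    (AlgTensor.of A A).symm.toLinearMap) ‖a‖ <|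
  norm_map_le _ _ (norm_nonneg a) fun b c => by
    rw [LinearMap.mulLeft_apply, LinearMap.id_apply, ← mul_assoc]
    gcongr
    exact norm_mul_le a b

/-- The map `b ⊗ c ↦ b ⊗ c a` on the algebraic tensor product. -/
def algRight (a : A) : AlgTensor A A →L[ℂ] AlgTensor A A :=
  LinearMap.mkContinuous ((AlgTensor.of A A).toLinearMap ∘ₗ
    TensorProduct.map LinearMap.id (LinearMap.mulRight ℂ a) ∘ₗ
    (AlgTensor.of A A).symm.toLinearMap) ‖a‖ <|
  norm_map_le _ _ (norm_nonneg a) fun b c => by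
    rw [LinearMap.mulRight_apply, LinearMap.id_apply, mul_left_comm, mul_comm ‖a‖]
    gcongr
    exact norm_mul_le c a

theorem algProduct_tmul (a b : A) : algProduct A (AlgTensor.of A A (a ⊗ₜ[ℂ] b)) = a * b := by
  simp [algProduct]

theorem algLeft_tmul (a b c : A) : algLeft a (AlgTensor.of A A (b ⊗ₜ[ℂ] c)) =
    AlgTensor.of A A ((a * b) ⊗ₜ[ℂ] c) := by
  simp [algLeft]

theorem algRight_tmul (a b c : A) : algRight a (AlgTensor.of A A (b ⊗ₜ[ℂ] c)) =
    AlgTensor.of A A (b ⊗ₜ[ℂ] (c * a)) := by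
  simp [algRight]

/-- The continuous product map `π : A ⊗̂ A → A`, `a ⊗ b ↦ a b`. -/
def productMap (A : Type u) [NonUnitalNormedRing A] [NormedSpace ℂ A] [IsScalarTower ℂ A A]
    [SMulCommClass ℂ A A] [CompleteSpace A] : ProjTensor A A → A :=
  UniformSpace.Completion.extension (algProduct A)

/-- The left action of `A` on `A ⊗̂ A`, `a · (b ⊗ c) = a b ⊗ c`. -/
def leftAct (a : A) : ProjTensor A A → ProjTensor A A :=
  UniformSpace.Completion.map (algLeft a)

/-- The right action of `A` on `A ⊗̂ A`, `(b ⊗ c) · a = b ⊗ c a`. -/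
def rightAct (d : ProjTensor A A) (a : A) : ProjTensor A A :=
  UniformSpace.Completion.map (algRight a) d

/-- The product map on `A ⊗̂ A` extends the one on the algebraic tensor product. -/
theorem productMap_coe [CompleteSpace A] (x : AlgTensor A A) :
    productMap A (x : ProjTensor A A) = algProduct A x :=
  UniformSpace.Completion.extension_coe (algProduct A).uniformContinuous x

theorem leftAct_coe (a : A) (x : AlgTensor A A) :
    leftAct a (x : ProjTensor A A) = (algLeft a x : AlgTensor A A) :=
  UniformSpace.Completion.map_coe (algLeft a).uniformContinuous x

theorem rightAct_coe (a : A) (x : AlgTensor A A) :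
    rightAct (x : ProjTensor A A) a = (algRight a x : AlgTensor A A) :=
  UniformSpace.Completion.map_coe (algRight a).uniformContinuous x

/-- A Banach algebra `A` is `K`-amenable if it has an approximate diagonal of bound `K`: a net
`(d_i)` in `A ⊗̂ A` with `‖d_i‖ ≤ K` for all `i` such that, for all `a ∈ A`, `π(d_i) a → a` and
`a · d_i - d_i · a → 0`. -/
def IsKAmenable (A : Type u) [NonUnitalNormedRing A] [NormedSpace ℂ A] [IsScalarTower ℂ A A]
    [SMulCommClass ℂ A A] [CompleteSpace A] (K : ℝ) : Prop :=
  ∃ (ι : Type u) (_ : Preorder ι) (_ : IsDirectedOrder ι) (_ : Nonempty ι)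
    (d : ι → ProjTensor A A),
    (∀ i, ‖d i‖ ≤ K) ∧
    (∀ a : A, Filter.Tendsto (fun i => productMap A (d i) * a) Filter.atTop (𝓝 a)) ∧
    (∀ a : A, Filter.Tendsto (fun i => leftAct a (d i) - rightAct (d i) a) Filter.atTop (𝓝 0))

end Amenable

instance (X : Type u) [NormedAddCommGroup X] [NormedSpace ℂ X] :
    NormedSpace ℂ (approximable X) where
  norm_smul_le a T := norm_smul_le a (T : X →L[ℂ] X)

instance (X : Type u) [NormedAddCommGroup X] [NormedSpace ℂ X] [CompleteSpace X] :
    CompleteSpace (approximable X) :=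
  (NonUnitalSubalgebra.isClosed_topologicalClosure (finiteRankAlgebra X)).completeSpace_coe

end OperatorIdeals

end

noncomputable section

namespace OperatorIdeals

/-! ### Approximate factorization -/

section Factorization

variable {E F : Type u} [NormedAddCommGroup E] [NormedSpace ℂ E]
  [NormedAddCommGroup F] [NormedSpace ℂ F]

/-! Write `Q = 1 - P`. If `∑ a ⊗ b` runs through an approximate diagonal of `𝓐(X)` and `S` is any
bounded operator on `X`, the operators `∑ a S b` are bounded and asymptotically commute with `𝓐(X)`.
Since rank-one operators act transitively, `∑ a S b` must act on finite-rank operators, in the limit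
along an ultrafilter, as a scalar (`tendsto_mul_of_asymptotically_central`). The scalars belonging
to `S = P` and `S = Q` add up to the scalar of `∑ a b`, which is `1`, so one of them has modulus at
least `1 / 2`.

Suppose it is the scalar `c` of `Q`. Compressing to `rg P` shows that `c⁻¹ ∑ (P a Q)(Q b P)` is an
approximate identity for the finite-rank operators on `rg P`. It factors through `rg Q` at total
cost at most `2 (K + 1) ‖P‖ ‖Q‖` (`IsKAmenable.approxFactors`). The other case is symmetric.

Such a factorization transports inequalities between ideal norms: `T` is close to `∑ u (v T)` with
`v T ∈ 𝓕(rg P, rg Q)`, and also to `∑ (T u) v` with `T u ∈ 𝓕(rg Q, rg P)`, so a comparison on either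
mixed space suffices (`NormBounds.of_approxFactors`). Which of the two ranges is obtained depends on
`P` only, not on the norms. -/

/-- The operator `∑ uᵢ vᵢ` on `E` given by a finite list of pairs `uᵢ : F → E`, `vᵢ : E → F`. -/
def factorSum (l : List ((F →L[ℂ] E) × (E →L[ℂ] F))) : E →L[ℂ] E :=
  (l.map fun p => p.1.comp p.2).sum

/-- The finite-rank operators on `E` are approximated, from the left and from the right, by their
products with operators `∑ uᵢ vᵢ` factoring through `F` with `∑ ‖uᵢ‖ ‖vᵢ‖ ≤ M`. -/
def ApproxFactors (E F : Type u) [NormedAddCommGroup E] [NormedSpace ℂ E]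
    [NormedAddCommGroup F] [NormedSpace ℂ F] (M : ℝ) : Prop :=
  ∀ T ∈ finiteRank E E, ∀ ε > 0, ∃ l : List ((F →L[ℂ] E) × (E →L[ℂ] F)), repCost l ≤ M ∧
    ‖T - (factorSum l).comp T‖ ≤ ε ∧
    ‖T - T.comp (factorSum l)‖ ≤ ε

theorem ApproxFactors.mono {M N : ℝ} (h : ApproxFactors E F M) (hMN : M ≤ N) :
    ApproxFactors E F N := fun T hT ε hε =>
  let ⟨l, hl, hl'⟩ := h T hT ε hε
  ⟨l, hl.trans hMN, hl'⟩

theorem factorSum_cons (p : (F →L[ℂ] E) × (E →L[ℂ] F)) (l : List ((F →L[ℂ] E) × (E →L[ℂ] F))) :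
    factorSum (p :: l) = p.1.comp p.2 + factorSum l := by
  simp [factorSum]

theorem repCost_cons (p : E × F) (l : List (E × F)) :
    repCost (p :: l) = ‖p.1‖ * ‖p.2‖ + repCost l := by
  simp [repCost]

end Factorization

/-! ### Composition with finite-rank operators and ideal norms -/

section IdealNorm

variable {E F G : Type u} [NormedAddCommGroup E] [NormedSpace ℂ E] [CompleteSpace E]
  [NormedAddCommGroup F] [NormedSpace ℂ F] [CompleteSpace F]
  [NormedAddCommGroup G] [NormedSpace ℂ G] [CompleteSpace G]

/-- `A T` as an element of `𝓕(E, G)`, for `T ∈ 𝓕(E, F)`. -/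
def finiteRank.compLeft (A : F →L[ℂ] G) (T : finiteRank E F) : finiteRank E G :=
  finiteRank.sandwich A T (ContinuousLinearMap.id ℂ E)

/-- `T B` as an element of `𝓕(E, G)`, for `T ∈ 𝓕(F, G)`. -/
def finiteRank.compRight (T : finiteRank F G) (B : E →L[ℂ] F) : finiteRank E G :=
  finiteRank.sandwich (ContinuousLinearMap.id ℂ G) T B

@[simp] theorem finiteRank.coe_compLeft (A : F →L[ℂ] G) (T : finiteRank E F) :
    (finiteRank.compLeft A T : E →L[ℂ] G) = A.comp (T : E →L[ℂ] F) := rfl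

@[simp] theorem finiteRank.coe_compRight (T : finiteRank F G) (B : E →L[ℂ] F) :
    (finiteRank.compRight T B : E →L[ℂ] G) = (T : F →L[ℂ] G).comp B := rfl

/-- A finite-rank operator is fixed by left multiplication with some finite-rank operator. -/
theorem finiteRank.exists_compLeft_eq (T : finiteRank E F) :
    ∃ Q : finiteRank F F, (Q : F →L[ℂ] F).comp (T : E →L[ℂ] F) = T := by
  have hT : FiniteDimensional ℂ (LinearMap.range ((T : E →L[ℂ] F) : E →ₗ[ℂ] F)) := T.2
  -- Finite-dimensional subspaces are complemented; `Q` is a bounded projection onto the range of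
  -- `T`.
  obtain ⟨q, hq⟩ := Submodule.ClosedComplemented.of_finiteDimensional
    (LinearMap.range ((T : E →L[ℂ] F) : E →ₗ[ℂ] F))
  refine ⟨⟨(Submodule.subtypeL _).comp q, ?_⟩, ?_⟩
  · rw [mem_finiteRank]
    refine Submodule.finiteDimensional_of_le
      (S₂ := LinearMap.range ((T : E →L[ℂ] F) : E →ₗ[ℂ] F)) ?_
    rintro _ ⟨x, rfl⟩
    exact (q x).2
  · ext x
    have := congrArg Subtype.val (hq ⟨(T : E →L[ℂ] F) x, x, rfl⟩)
    simpa using this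

/-- A finite-rank operator is fixed by right multiplication with some finite-rank operator. -/
theorem finiteRank.exists_compRight_eq (T : finiteRank E F) :
    ∃ R : finiteRank E E, (T : E →L[ℂ] F).comp (R : E →L[ℂ] E) = T := by
  have hT : FiniteDimensional ℂ (LinearMap.range ((T : E →L[ℂ] F) : E →ₗ[ℂ] F)) := T.2
  set T₀ : E →L[ℂ] LinearMap.range ((T : E →L[ℂ] F) : E →ₗ[ℂ] F) :=
    (T : E →L[ℂ] F).codRestrict _ (fun x => ⟨x, rfl⟩) with hT₀
  have hsurj : T₀.range = ⊤ := by
    rw [LinearMap.range_eq_top]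
    rintro ⟨_, x, rfl⟩
    exact ⟨x, rfl⟩
  -- `T` is surjective onto its finite-dimensional range, so it has a bounded right inverse `S`
  -- there, and `R = S T` satisfies `T R = T`.
  obtain ⟨S, hS⟩ := T₀.exists_rightInverse_of_surjective hsurj
  refine ⟨⟨S.comp T₀, ?_⟩, ?_⟩
  · rw [mem_finiteRank]
    refine Submodule.finiteDimensional_of_le (S₂ := S.range) ?_
    rintro _ ⟨x, rfl⟩
    exact ⟨T₀ x, rfl⟩
  · ext x
    exact congrArg Subtype.val (DFunLike.congr_fun hS (T₀ x))

namespace OperatorIdealNorm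

variable (τ γ : OperatorIdealNorm.{u})

theorem toFun_zero : τ.toFun (0 : finiteRank E F) = 0 := by
  simpa using τ.map_smul 0 (0 : finiteRank E F)

theorem toFun_compLeft_le (A : F →L[ℂ] G) (T : finiteRank E F) :
    τ.toFun (finiteRank.compLeft A T) ≤ ‖A‖ * τ.toFun T :=
  (τ.ideal A T (ContinuousLinearMap.id ℂ E)).trans <|
    mul_le_of_le_one_right (mul_nonneg (norm_nonneg _) (τ.nonneg T))
      ContinuousLinearMap.norm_id_le

theorem toFun_compRight_le (T : finiteRank F G) (B : E →L[ℂ] F) :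
    τ.toFun (finiteRank.compRight T B) ≤ τ.toFun T * ‖B‖ := by
  refine (τ.ideal (ContinuousLinearMap.id ℂ G) T B).trans ?_
  have h : ‖ContinuousLinearMap.id ℂ G‖ ≤ 1 := ContinuousLinearMap.norm_id_le
  gcongr
  exact mul_le_of_le_one_left (τ.nonneg T) h

end OperatorIdealNorm

namespace OperatorIdealNorm

variable {τ γ : OperatorIdealNorm.{u}} {C : ℝ}

/-- Each term is `u (v T)`: the ideal property strips off `u`, the comparison is applied to `v T`,
which maps `E` to `F`, and the ideal property of `γ` then strips off `v`. -/
theorem toFun_factorSum_compLeft_le (hC : 0 ≤ C)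
    (h : ∀ T : finiteRank E F, τ.toFun T ≤ C * γ.toFun T)
    (l : List ((F →L[ℂ] E) × (E →L[ℂ] F))) (T : finiteRank E E) :
    τ.toFun (finiteRank.compLeft (factorSum l) T) ≤ C * repCost l * γ.toFun T := by
  induction l with
  | nil =>
    have h0 : finiteRank.compLeft (factorSum ([] : List ((F →L[ℂ] E) × (E →L[ℂ] F)))) T = 0 := by
      ext x
      simp [factorSum]
    rw [h0, toFun_zero]
    simp [repCost]
  | cons p l ih =>
    have h0 : finiteRank.compLeft (factorSum (p :: l)) T =
        finiteRank.compLeft p.1 (finiteRank.compLeft p.2 T) +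
          finiteRank.compLeft (factorSum l) T := by
      ext x
      simp [factorSum_cons]
    have h1 : τ.toFun (finiteRank.compLeft p.1 (finiteRank.compLeft p.2 T)) ≤
        ‖p.1‖ * (C * (‖p.2‖ * γ.toFun T)) := by
      refine (toFun_compLeft_le τ _ _).trans ?_
      gcongr
      refine (h _).trans ?_
      gcongr
      exact toFun_compLeft_le γ _ _
    rw [h0, repCost_cons]
    refine (τ.add_le _ _).trans ((add_le_add h1 ih).trans (le_of_eq ?_))
    ring

/-- Mirror image: the terms are `(T u) v`, and the comparison is applied to `T u`, which maps `F` to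
`E`. -/
theorem toFun_factorSum_compRight_le (hC : 0 ≤ C)
    (h : ∀ T : finiteRank F E, τ.toFun T ≤ C * γ.toFun T)
    (l : List ((F →L[ℂ] E) × (E →L[ℂ] F))) (T : finiteRank E E) :
    τ.toFun (finiteRank.compRight T (factorSum l)) ≤ C * repCost l * γ.toFun T := by
  induction l with
  | nil =>
    have h0 : finiteRank.compRight T (factorSum ([] : List ((F →L[ℂ] E) × (E →L[ℂ] F)))) = 0 := by
      ext x
      simp [factorSum]
    rw [h0, toFun_zero]
    simp [repCost]
  | cons p l ih =>
    have h0 : finiteRank.compRight T (factorSum (p :: l)) =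
        finiteRank.compRight (finiteRank.compRight T p.1) p.2 +
          finiteRank.compRight T (factorSum l) := by
      ext x
      simp [factorSum_cons]
    have h1 : τ.toFun (finiteRank.compRight (finiteRank.compRight T p.1) p.2) ≤
        C * (γ.toFun T * ‖p.1‖) * ‖p.2‖ := by
      refine (toFun_compRight_le τ _ _).trans ?_
      gcongr
      refine (h _).trans ?_
      gcongr
      exact toFun_compRight_le γ _ _
    rw [h0, repCost_cons]
    refine (τ.add_le _ _).trans ((add_le_add h1 ih).trans (le_of_eq ?_))
    ring

/-- A bound of one ideal norm by another on `𝓕(E, F)` passes to `𝓕(E)` if the finite-rank operators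
on `E` approximately factor through `F`. -/
theorem toFun_le_of_approxFactors {M : ℝ} (hM : ApproxFactors E F M) (hC : 0 ≤ C)
    (h : (∀ T : finiteRank E F, τ.toFun T ≤ C * γ.toFun T) ∨
      ∀ T : finiteRank F E, τ.toFun T ≤ C * γ.toFun T) (T : finiteRank E E) :
    τ.toFun T ≤ C * M * γ.toFun T := by
  refine le_of_forall_pos_le_add fun ε hε => ?_
  -- The tolerance `ε / (τ(T) + 1)` turns an operator-norm error into a `τ`-error of at most `ε`;
  -- the `1` avoids division by zero.
  have hpos : 0 < τ.toFun T + 1 := by linarith [τ.nonneg T]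
  have hδ : ε / (τ.toFun T + 1) * τ.toFun T ≤ ε := by
    rw [div_mul_eq_mul_div, div_le_iff₀ hpos]
    nlinarith
  rcases h with h | h
  -- Factoring `T` itself would leave an error small only in operator norm. Since `T = Q T`, the
  -- error becomes `(Q - ∑ u v Q) T`, which the ideal property bounds in `τ`.
  · obtain ⟨Q, hQ⟩ := finiteRank.exists_compLeft_eq T
    obtain ⟨l, hl, hl', -⟩ := hM Q Q.2 (ε / (τ.toFun T + 1)) (div_pos hε hpos)
    have h0 : T = finiteRank.compLeft (factorSum l) T +
        finiteRank.compLeft ((Q : E →L[ℂ] E) - (factorSum l).comp (Q : E →L[ℂ] E)) T := by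
      ext x
      have := DFunLike.congr_fun hQ x
      simp only [ContinuousLinearMap.comp_apply] at this
      simp [this]
    have h1 := toFun_factorSum_compLeft_le hC h l T
    have h2 := toFun_compLeft_le τ
      ((Q : E →L[ℂ] E) - (factorSum l).comp (Q : E →L[ℂ] E)) T
    calc τ.toFun T ≤ _ := (congrArg τ.toFun h0).le.trans (τ.add_le _ _)
      _ ≤ C * repCost l * γ.toFun T + ε / (τ.toFun T + 1) * τ.toFun T :=
        add_le_add h1 (h2.trans (mul_le_mul_of_nonneg_right hl' (τ.nonneg T)))
      _ ≤ C * M * γ.toFun T + ε := by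
        have := γ.nonneg T
        gcongr
  · obtain ⟨R, hR⟩ := finiteRank.exists_compRight_eq T
    obtain ⟨l, hl, -, hl'⟩ := hM R R.2 (ε / (τ.toFun T + 1)) (div_pos hε hpos)
    have h0 : T = finiteRank.compRight T (factorSum l) +
        finiteRank.compRight T ((R : E →L[ℂ] E) - (R : E →L[ℂ] E).comp (factorSum l)) := by
      ext x
      have h3 := DFunLike.congr_fun hR x
      have h4 := DFunLike.congr_fun hR (factorSum l x)
      simp only [ContinuousLinearMap.comp_apply] at h3 h4
      simp [h3, h4]
    have h1 := toFun_factorSum_compRight_le hC h l T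
    have h2 := toFun_compRight_le τ T
      ((R : E →L[ℂ] E) - (R : E →L[ℂ] E).comp (factorSum l))
    rw [mul_comm] at h2
    calc τ.toFun T ≤ _ := (congrArg τ.toFun h0).le.trans (τ.add_le _ _)
      _ ≤ C * repCost l * γ.toFun T + ε / (τ.toFun T + 1) * τ.toFun T :=
        add_le_add h1 (h2.trans (mul_le_mul_of_nonneg_right hl' (τ.nonneg T)))
      _ ≤ C * M * γ.toFun T + ε := by
        have := γ.nonneg T
        gcongr

end OperatorIdealNorm

/-- Equivalence of ideal norms on `𝓕(E, F)` or `𝓕(F, E)` passes to `𝓕(E)` if the finite-rank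
operators on `E` approximately factor through `F`. -/
theorem NormBounds.of_approxFactors {γ τ : OperatorIdealNorm.{u}} {c C M : ℝ} (hM : 0 < M)
    (hEF : ApproxFactors E F M) (hc : 0 < c) (hC : 0 < C)
    (h : NormBounds γ τ c C E F ∨ NormBounds γ τ c C F E) :
    NormBounds γ τ (c * M⁻¹) (C * M) E E := by
  intro T
  have h1 : τ.toFun T ≤ C * M * γ.toFun T :=
    OperatorIdealNorm.toFun_le_of_approxFactors hEF hC.le
      (h.imp (fun h S => (h S).2) fun h S => (h S).2) T
  -- The lower bound is the upper bound with `γ` and `τ` exchanged and `c⁻¹` in place of `C`.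
  have h2 : γ.toFun T ≤ c⁻¹ * M * τ.toFun T :=
    OperatorIdealNorm.toFun_le_of_approxFactors hEF (inv_nonneg.2 hc.le)
      (h.imp (fun h S => (le_inv_mul_iff₀ hc).2 (h S).1)
        fun h S => (le_inv_mul_iff₀ hc).2 (h S).1) T
  refine ⟨?_, h1⟩
  calc c * M⁻¹ * γ.toFun T ≤ c * M⁻¹ * (c⁻¹ * M * τ.toFun T) := by gcongr
    _ = τ.toFun T := by field_simp

end IdealNorm

/-! ### Approximate diagonals in the algebraic tensor product -/

section Diagonal

variable {A : Type u} [NonUnitalNormedRing A] [NormedSpace ℂ A] [IsScalarTower ℂ A A]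
  [SMulCommClass ℂ A A]

theorem norm_productMap_sub_le [CompleteSpace A] (d : ProjTensor A A) (x : AlgTensor A A) :
    ‖productMap A d - algProduct A x‖ ≤ ‖d - x‖ := by
  have h1 : LipschitzWith 1 (algProduct A) := by
    refine AddMonoidHomClass.lipschitz_of_bound_nnnorm _ 1 fun y => ?_
    rw [← NNReal.coe_le_coe]
    simpa [algProduct] using norm_mul'_le y
  have h2 := h1.completion_extension.dist_le_mul d x
  rw [UniformSpace.Completion.extension_coe h1.uniformContinuous, dist_eq_norm, dist_eq_norm] at h2
  simpa [productMap] using h2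

theorem norm_completion_map_sub_le {V W : Type*} [SeminormedAddCommGroup V] [NormedSpace ℂ V]
    [SeminormedAddCommGroup W] [NormedSpace ℂ W] (f : V →L[ℂ] W) {C : NNReal} (hf : ‖f‖ ≤ C)
    (d : UniformSpace.Completion V) (x : V) :
    ‖UniformSpace.Completion.map f d - (f x : W)‖ ≤ C * ‖d - x‖ := by
  have h1 : LipschitzWith C f :=
    f.lipschitz.weaken (by exact_mod_cast hf)
  have h2 := h1.completion_map.dist_le_mul d x
  rwa [UniformSpace.Completion.map_coe h1.uniformContinuous, dist_eq_norm, dist_eq_norm] at h2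

theorem norm_leftAct_sub_le (a : A) (d : ProjTensor A A) (x : AlgTensor A A) :
    ‖leftAct a d - (algLeft a x : AlgTensor A A)‖ ≤ ‖a‖ * ‖d - x‖ :=
  norm_completion_map_sub_le (algLeft a) (C := ‖a‖₊)
    (LinearMap.mkContinuous_norm_le _ (norm_nonneg a) _) d x

theorem norm_rightAct_sub_le (a : A) (d : ProjTensor A A) (x : AlgTensor A A) :
    ‖rightAct d a - (algRight a x : AlgTensor A A)‖ ≤ ‖a‖ * ‖d - x‖ :=
  norm_completion_map_sub_le (algRight a) (C := ‖a‖₊)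
    (LinearMap.mkContinuous_norm_le _ (norm_nonneg a) _) d x

/-- Both module actions of `a` have norm at most `‖a‖`, whence the factor `2` when `d` is replaced
by a nearby algebraic tensor. -/
theorem norm_commutator_le (a : A) (d : ProjTensor A A) (x : AlgTensor A A) :
    ‖algLeft a x - algRight a x‖ ≤ ‖leftAct a d - rightAct d a‖ + 2 * ‖a‖ * ‖d - x‖ := by
  have h1 := norm_leftAct_sub_le a d x
  have h2 := norm_rightAct_sub_le a d x
  rw [← UniformSpace.Completion.norm_coe, UniformSpace.Completion.coe_sub]
  have h3 : ((algLeft a x : AlgTensor A A) : ProjTensor A A) - (algRight a x : AlgTensor A A) =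
      (leftAct a d - rightAct d a) - (leftAct a d - (algLeft a x : AlgTensor A A)) +
        (rightAct d a - (algRight a x : AlgTensor A A)) := by abel
  rw [h3]
  refine (norm_add_le _ _).trans ?_
  have h4 := norm_sub_le (leftAct a d - rightAct d a) (leftAct a d - (algLeft a x : AlgTensor A A))
  linarith

/-- A bounded approximate diagonal can be chosen in the algebraic tensor product, along an
ultrafilter. -/
theorem IsKAmenable.exists_algebraic [CompleteSpace A] {K : ℝ} (h : IsKAmenable A K) :
    ∃ (J : Type u) (U : Ultrafilter J) (l : J → List (A × A)),
      (∀ j, repCost (l j) ≤ K + 1) ∧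
      (∀ a : A, Filter.Tendsto (fun j => LinearMap.mul' ℂ A (repSum (l j)) * a) U (𝓝 a)) ∧
      ∀ a : A, Filter.Tendsto (fun j => projNorm
        (TensorProduct.map (LinearMap.mulLeft ℂ a) LinearMap.id (repSum (l j)) -
          TensorProduct.map LinearMap.id (LinearMap.mulRight ℂ a) (repSum (l j)))) U (𝓝 0) := by
  obtain ⟨ι, _, _, _, d, hd, hd1, hd2⟩ := h
  -- The index `n` in `ι × ℕ` makes the approximation error tend to `0`. As this error is below `1`,
  -- the algebraic tensor has projective norm strictly less than `K + 1`, which leaves room for a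
  -- representing list of cost at most `K + 1`.
  have happ : ∀ p : ι × ℕ, ∃ l : List (A × A), repCost l ≤ K + 1 ∧
      ‖d p.1 - (AlgTensor.of A A (repSum l) : AlgTensor A A)‖ ≤ 1 / ((p.2 : ℝ) + 1) := by
    intro p
    have hp : (0 : ℝ) < 1 / ((p.2 : ℝ) + 1) := by positivity
    have hp1 : 1 / ((p.2 : ℝ) + 1) ≤ 1 := by
      rw [div_le_one (by positivity)]
      linarith [(Nat.cast_nonneg p.2 : (0 : ℝ) ≤ p.2)]
    obtain ⟨x, hx⟩ := UniformSpace.Completion.denseRange_coe.exists_dist_lt (d p.1) hp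
    rw [dist_eq_norm] at hx
    have hx1 : ‖x‖ < K + 1 := by
      rw [← UniformSpace.Completion.norm_coe]
      have := norm_sub_norm_le (x : ProjTensor A A) (d p.1)
      rw [norm_sub_rev] at this
      linarith [hd p.1]
    rw [AlgTensor.norm_def] at hx1
    obtain ⟨l₀, hl₀⟩ := exists_repSum ((AlgTensor.of A A).symm x)
    obtain ⟨_, ⟨l, hl, rfl⟩, hl'⟩ := exists_lt_of_csInf_lt
      (s := repCost '' {l : List (A × A) | repSum l = (AlgTensor.of A A).symm x})
      ⟨_, l₀, hl₀, rfl⟩ hx1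
    refine ⟨l, hl'.le, ?_⟩
    have hl2 : repSum l = (AlgTensor.of A A).symm x := hl
    rw [hl2, LinearEquiv.apply_symm_apply]
    exact hx.le
  choose l hl hl' using happ
  have h0 : Filter.Tendsto (fun p : ι × ℕ => ‖d p.1 - (AlgTensor.of A A (repSum (l p)))‖)
      (Filter.atTop ×ˢ Filter.atTop) (𝓝 0) :=
    squeeze_zero (fun _ => norm_nonneg _) hl'
      (tendsto_one_div_add_atTop_nhds_zero_nat.comp Filter.tendsto_snd)
  -- Along an ultrafilter every bounded scalar net converges, so no subnets need be chosen later.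
  refine ⟨ι × ℕ, Ultrafilter.of (Filter.atTop ×ˢ Filter.atTop), l, hl, fun a => ?_, fun a => ?_⟩
  · refine Filter.Tendsto.mono_left ?_ (Ultrafilter.of_le _)
    have h1 : Filter.Tendsto (fun p : ι × ℕ => productMap A (d p.1) * a)
      (Filter.atTop ×ˢ Filter.atTop) (𝓝 a) := (hd1 a).comp Filter.tendsto_fst
    refine h1.congr_dist ?_
    refine squeeze_zero (fun _ => dist_nonneg) (fun p => ?_) (by simpa using h0.mul_const ‖a‖)
    rw [dist_eq_norm, ← sub_mul]
    refine (norm_mul_le _ _).trans ?_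
    gcongr
    exact norm_productMap_sub_le (d p.1) (AlgTensor.of A A (repSum (l p)))
  · refine Filter.Tendsto.mono_left ?_ (Ultrafilter.of_le _)
    have h1 : Filter.Tendsto (fun p : ι × ℕ => leftAct a (d p.1) - rightAct (d p.1) a)
      (Filter.atTop ×ˢ Filter.atTop) (𝓝 0) := (hd2 a).comp Filter.tendsto_fst
    have h2 := h1.norm.add (h0.const_mul (2 * ‖a‖))
    rw [norm_zero, mul_zero, add_zero] at h2
    exact squeeze_zero (fun _ => projNorm_nonneg _)
      (fun p => norm_commutator_le a (d p.1) (AlgTensor.of A A (repSum (l p)))) h2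

/-- The product map is contractive, so `‖π(d_i) a‖ ≤ K ‖a‖`, while the left side tends to `‖a‖`. -/
theorem IsKAmenable.one_le [CompleteSpace A] [Nontrivial A] {K : ℝ} (h : IsKAmenable A K) :
    1 ≤ K := by
  obtain ⟨ι, _, _, _, d, hd, hd1, -⟩ := h
  obtain ⟨a, ha⟩ := exists_ne (0 : A)
  have h1 : ‖a‖ ≤ K * ‖a‖ := by
    refine le_of_tendsto (hd1 a).norm (Filter.Eventually.of_forall fun i => ?_)
    refine (norm_mul_le _ _).trans ?_
    gcongr
    have h2 := norm_productMap_sub_le (d i) 0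
    rw [map_zero, UniformSpace.Completion.coe_zero, sub_zero, sub_zero] at h2
    exact h2.trans (hd i)
  exact le_of_mul_le_mul_right (by simpa using h1) (norm_pos_iff.2 ha)

end Diagonal

/-! ### Inserting an element into a tensor -/

section Insert

variable {A : Type u} [NonUnitalNormedRing A] [NormedSpace ℂ A] [IsScalarTower ℂ A A]
  [SMulCommClass ℂ A A] {B : Type*} [NormedRing B] [NormedAlgebra ℂ B]

/-- The element `∑ φ(a) s φ(b)` given by a finite list of pairs `(a, b)`. -/
def insertSum {A B : Type*} [Ring B] (φ : A → B) (s : B) (l : List (A × A)) : B :=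
  (l.map fun p => φ p.1 * s * φ p.2).sum

theorem insertSum_cons {A B : Type*} [Ring B] (φ : A → B) (s : B) (p : A × A) (l : List (A × A)) :
    insertSum φ s (p :: l) = φ p.1 * s * φ p.2 + insertSum φ s l := by
  simp [insertSum]

theorem insertSum_add {A B : Type*} [Ring B] (φ : A → B) (s t : B) (l : List (A × A)) :
    insertSum φ (s + t) l = insertSum φ s l + insertSum φ t l := by
  induction l with
  | nil => simp [insertSum]
  | cons p l ih =>
    simp only [insertSum_cons, ih, mul_add, add_mul]
    abel

/-- The linear map `a ⊗ b ↦ φ(a) s φ(b)`. -/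
def insertMap (φ : A →ₗ[ℂ] B) (s : B) : A ⊗[ℂ] A →ₗ[ℂ] B :=
  TensorProduct.lift <| LinearMap.mk₂ ℂ (fun a b => φ a * s * φ b)
    (fun a b c => by simp [add_mul]) (fun r a b => by simp)
    (fun a b c => by simp [mul_add]) (fun r a b => by simp)

@[simp] theorem insertMap_tmul (φ : A →ₗ[ℂ] B) (s : B) (a b : A) :
    insertMap φ s (a ⊗ₜ[ℂ] b) = φ a * s * φ b := rfl

theorem insertMap_repSum (φ : A →ₗ[ℂ] B) (s : B) (l : List (A × A)) :
    insertMap φ s (repSum l) = insertSum φ s l := by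
  simp [repSum, insertSum, map_list_sum, Function.comp_def]

theorem insertMap_one (φ : A →ₗ[ℂ] B) (hφ : ∀ a b, φ (a * b) = φ a * φ b) (x : A ⊗[ℂ] A) :
    insertMap φ 1 x = φ (LinearMap.mul' ℂ A x) := by
  induction x using TensorProduct.induction_on with
  | zero => simp
  | tmul a b => simp [hφ]
  | add x y hx hy => simp [hx, hy]

theorem norm_insertMap_le {φ : A →ₗ[ℂ] B} (hφ : ∀ a, ‖φ a‖ ≤ ‖a‖) (s : B) (x : A ⊗[ℂ] A) :
    ‖insertMap φ s x‖ ≤ ‖s‖ * projNorm x := by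
  refine le_mul_projNorm (N := fun x => ‖insertMap φ s x‖) ?_ ?_ (norm_nonneg s) ?_ x
  · simp
  · intro x y
    simpa using norm_add_le (insertMap φ s x) (insertMap φ s y)
  · intro a b
    rw [insertMap_tmul]
    calc ‖φ a * s * φ b‖ ≤ ‖φ a‖ * ‖s‖ * ‖φ b‖ := norm_mul₃_le
      _ ≤ ‖a‖ * ‖s‖ * ‖b‖ := by
        gcongr
        · exact hφ a
        · exact hφ b
      _ = ‖s‖ * (‖a‖ * ‖b‖) := by ring

/-- Together with `insertMap_mulRight`, this makes `insertMap φ s` a bimodule map, so it carries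
commutators with the diagonal to commutators with `∑ φ(a) s φ(b)`. -/
theorem insertMap_mulLeft {φ : A →ₗ[ℂ] B} (hφ : ∀ a b, φ (a * b) = φ a * φ b) (s : B) (a : A)
    (x : A ⊗[ℂ] A) :
    insertMap φ s (TensorProduct.map (LinearMap.mulLeft ℂ a) LinearMap.id x) =
      φ a * insertMap φ s x := by
  induction x using TensorProduct.induction_on with
  | zero => simp
  | tmul b c => simp [mul_assoc, hφ]
  | add x y hx hy => simp [hx, hy, mul_add]

theorem insertMap_mulRight {φ : A →ₗ[ℂ] B} (hφ : ∀ a b, φ (a * b) = φ a * φ b) (s : B) (a : A)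
    (x : A ⊗[ℂ] A) :
    insertMap φ s (TensorProduct.map LinearMap.id (LinearMap.mulRight ℂ a) x) =
      insertMap φ s x * φ a := by
  induction x using TensorProduct.induction_on with
  | zero => simp
  | tmul b c => simp [mul_assoc, hφ]
  | add x y hx hy => simp [hx, hy, add_mul]

/-- For a contractive homomorphism `φ : A → B` from a `K`-amenable algebra there is a net of finite
lists of pairs `(a, b)` such that the elements `∑ φ(a) s φ(b)` are bounded and asymptotically
commute with `φ(A)`, for every `s`, and form an approximate unit of `φ(A)` for `s = 1`. -/
theorem IsKAmenable.exists_insertSum [CompleteSpace A] {K : ℝ} (h : IsKAmenable A K)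
    (φ : A →ₗ[ℂ] B) (hφ : ∀ a b, φ (a * b) = φ a * φ b) (hφ' : ∀ a, ‖φ a‖ ≤ ‖a‖) :
    ∃ (J : Type u) (U : Ultrafilter J) (l : J → List (A × A)),
      (∀ j, repCost (l j) ≤ K + 1) ∧
      (∀ s j, ‖insertSum φ s (l j)‖ ≤ ‖s‖ * (K + 1)) ∧
      (∀ a, Filter.Tendsto (fun j => insertSum φ 1 (l j) * φ a) U (𝓝 (φ a))) ∧
      ∀ s a, Filter.Tendsto
        (fun j => φ a * insertSum φ s (l j) - insertSum φ s (l j) * φ a) U (𝓝 0) := by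
  obtain ⟨J, U, l, hl, hone, hcomm⟩ := h.exists_algebraic
  refine ⟨J, U, l, hl, fun s j => ?_, fun a => ?_, fun s a => ?_⟩
  · rw [← insertMap_repSum]
    refine (norm_insertMap_le hφ' _ _).trans ?_
    gcongr
    exact (projNorm_le _).trans (hl j)
  · have hcont : Continuous φ :=
      (φ.mkContinuous 1 fun a => (hφ' a).trans (one_mul ‖a‖).ge).continuous
    refine ((hcont.tendsto _).comp (hone a)).congr fun j => ?_
    rw [Function.comp_apply, hφ, ← insertMap_repSum, insertMap_one φ hφ]
  · have h1 := (hcomm a).const_mul ‖s‖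
    rw [mul_zero] at h1
    refine squeeze_zero_norm (fun j => ?_) h1
    refine le_trans (le_of_eq ?_) (norm_insertMap_le hφ' s _)
    rw [map_sub, insertMap_mulLeft hφ, insertMap_mulRight hφ, insertMap_repSum]

end Insert

/-! ### Finite-rank operators and asymptotically central nets -/

section Central

variable {X : Type u} [NormedAddCommGroup X] [NormedSpace ℂ X]

theorem mem_approximable_of_mem_finiteRank {T : X →L[ℂ] X} (hT : T ∈ finiteRank X X) :
    T ∈ approximable X :=
  NonUnitalSubalgebra.le_topologicalClosure (finiteRankAlgebra X) hT

theorem smulRight_mem_finiteRank (g : X →L[ℂ] ℂ) (x : X) : g.smulRight x ∈ finiteRank X X := by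
  rw [mem_finiteRank]
  refine Submodule.finiteDimensional_of_le (S₂ := Submodule.span ℂ {x}) ?_
  rintro _ ⟨y, rfl⟩
  exact Submodule.smul_mem _ _ (Submodule.mem_span_singleton_self x)

/-- A finite-rank operator is a finite sum of rank-one operators. -/
theorem exists_eq_sum_smulRight {T : X →L[ℂ] X} (hT : T ∈ finiteRank X X) :
    ∃ (n : ℕ) (g : Fin n → X →L[ℂ] ℂ) (x : Fin n → X), T = ∑ i, (g i).smulRight (x i) := by
  have hT' : FiniteDimensional ℂ (LinearMap.range (T : X →ₗ[ℂ] X)) := hT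
  let b := Module.finBasis ℂ (LinearMap.range (T : X →ₗ[ℂ] X))
  let T₀ : X →L[ℂ] LinearMap.range (T : X →ₗ[ℂ] X) := T.codRestrict _ (fun x => ⟨x, rfl⟩)
  refine ⟨_, fun i => (LinearMap.toContinuousLinearMap (b.coord i)).comp T₀,
    fun i => (b i : X), ?_⟩
  ext x
  have h := congrArg Subtype.val (b.sum_repr (T₀ x))
  simp only [AddSubmonoidClass.coe_finsetSum, Submodule.coe_smul] at h
  simp only [_root_.sum_apply, ContinuousLinearMap.smulRight_apply]
  exact h.symm

/-- Operators which are bounded and asymptotically commute with the approximable operators act on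
the finite-rank operators, in the limit, as a scalar. -/
theorem tendsto_mul_of_asymptotically_central {J : Type*} {U : Filter J}
    {M : J → X →L[ℂ] X}
    (hM : ∀ a ∈ finiteRank X X, Filter.Tendsto (fun j => a * M j - M j * a) U (𝓝 0))
    {f : X →L[ℂ] ℂ} {e : X} (hfe : f e = 1) {c : ℂ}
    (hc : Filter.Tendsto (fun j => f (M j e)) U (𝓝 c))
    {a : X →L[ℂ] X} (ha : a ∈ finiteRank X X) :
    Filter.Tendsto (fun j => M j * a) U (𝓝 (c • a)) ∧
      Filter.Tendsto (fun j => a * M j) U (𝓝 (c • a)) := by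
  have hrank : ∀ (g : X →L[ℂ] ℂ) (x : X),
      Filter.Tendsto (fun j => M j * g.smulRight x) U (𝓝 (c • g.smulRight x)) := by
    intro g x
    -- Apply the commutator of `M j` with the rank-one operator `y ↦ f(y) x` to `y ↦ g(y) e`. As `f
    -- e = 1`, the result is `f(M j e)` times `y ↦ g(y) x`, minus `M j` composed with that operator.
    have h1 := ((hM _ (smulRight_mem_finiteRank f x)).mul_const (g.smulRight e)).neg
    have h2 := h1.add (hc.smul_const (g.smulRight x))
    rw [zero_mul, neg_zero, zero_add] at h2
    refine h2.congr fun j => ?_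
    ext y
    simp [hfe, smul_sub, smul_smul, mul_comm]
  have hleft : Filter.Tendsto (fun j => M j * a) U (𝓝 (c • a)) := by
    obtain ⟨n, g, x, rfl⟩ := exists_eq_sum_smulRight ha
    simp only [Finset.mul_sum, Finset.smul_sum]
    exact tendsto_finsetSum _ fun i _ => hrank (g i) (x i)
  refine ⟨hleft, ?_⟩
  have h3 := (hM a ha).add hleft
  rw [zero_add] at h3
  exact h3.congr fun j => by abel

end Central

/-! ### Compression to the ranges of projections -/

section Compression

variable {X : Type u} [NormedAddCommGroup X] [NormedSpace ℂ X]

/-- An operator, viewed as an operator onto its range. -/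
def toRange (P : X →L[ℂ] X) : X →L[ℂ] rg P := P.codRestrict _ fun x => ⟨x, rfl⟩

@[simp] theorem coe_toRange (P : X →L[ℂ] X) (x : X) : (toRange P x : X) = P x := rfl

theorem norm_toRange_le (P : X →L[ℂ] X) : ‖toRange P‖ ≤ ‖P‖ :=
  ContinuousLinearMap.opNorm_le_bound _ (norm_nonneg P) fun x => P.le_opNorm x

theorem toRange_coe {P : X →L[ℂ] X} (hP : IsIdempotentElem P) (x : rg P) :
    toRange P (x : X) = x := by
  obtain ⟨_, y, rfl⟩ := x
  exact Subtype.ext (DFunLike.congr_fun hP.eq y)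

/-- The compression of an operator on `X` to an operator `rg Q → rg P`. -/
def compress (P Q a : X →L[ℂ] X) : rg Q →L[ℂ] rg P :=
  (toRange P).comp (a.comp (rg Q).subtypeL)

/-- Only `‖P‖` enters, because the inclusion of `rg Q` is contractive; hence one factor of each
projection norm in the final cost. -/
theorem norm_compress_le (P Q a : X →L[ℂ] X) : ‖compress P Q a‖ ≤ ‖P‖ * ‖a‖ := by
  refine (ContinuousLinearMap.opNorm_comp_le _ _).trans ?_
  gcongr
  · exact norm_toRange_le P
  · exact (ContinuousLinearMap.opNorm_comp_le _ _).trans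
      (mul_le_of_le_one_right (norm_nonneg a) (Submodule.norm_subtypeL_le _))

/-- The pairs `(P a Q, Q b P)`, up to a scalar, for the pairs `(a, b)` in a list. -/
def compressList (P Q : X →L[ℂ] X) (r : ℂ) (l : List (approximable X × approximable X)) :
    List ((rg Q →L[ℂ] rg P) × (rg P →L[ℂ] rg Q)) :=
  l.map fun p => (r • compress P Q p.1, compress Q P p.2)

theorem repCost_compressList_le (P Q : X →L[ℂ] X) (r : ℂ)
    (l : List (approximable X × approximable X)) :
    repCost (compressList P Q r l) ≤ ‖r‖ * ‖P‖ * ‖Q‖ * repCost l := by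
  induction l with
  | nil => simp [compressList, repCost]
  | cons p l ih =>
    have h : compressList P Q r (p :: l) =
      (r • compress P Q p.1, compress Q P p.2) :: compressList P Q r l := rfl
    rw [h, repCost_cons, repCost_cons, mul_add]
    refine add_le_add ?_ ih
    have h0 : ‖r • compress P Q p.1‖ ≤ ‖r‖ * ‖compress P Q p.1‖ :=
      ContinuousLinearMap.opNorm_smul_le r (compress P Q p.1)
    have h1 := norm_compress_le P Q p.1
    have h2 := norm_compress_le Q P p.2
    calc ‖r • compress P Q p.1‖ * ‖compress Q P p.2‖
        ≤ ‖r‖ * ‖compress P Q p.1‖ * ‖compress Q P p.2‖ := by gcongr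
      _ ≤ ‖r‖ * (‖P‖ * ‖(p.1 : X →L[ℂ] X)‖) * (‖Q‖ * ‖(p.2 : X →L[ℂ] X)‖) := by gcongr
      _ = ‖r‖ * ‖P‖ * ‖Q‖ * (‖p.1‖ * ‖p.2‖) := by
        change _ = ‖r‖ * ‖P‖ * ‖Q‖ * (‖(p.1 : X →L[ℂ] X)‖ * ‖(p.2 : X →L[ℂ] X)‖)
        ring

/-- The middle operator `Q` arises from passing through `rg Q`: `(P a Q)(Q b P)` is the compression
of `a Q b` to `rg P`. -/
theorem factorSum_compressList (P Q : X →L[ℂ] X) (r : ℂ)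
    (l : List (approximable X × approximable X)) :
    factorSum (compressList P Q r l) = r • compress P P (insertSum Subtype.val Q l) := by
  induction l with
  | nil =>
    ext x
    simp [compressList, factorSum, insertSum, compress]
  | cons p l ih =>
    have h : compressList P Q r (p :: l) =
      (r • compress P Q p.1, compress Q P p.2) :: compressList P Q r l := rfl
    rw [h, factorSum_cons, ih, insertSum_cons]
    ext x
    simp [compress]

/-- If the operators `∑ a Q b`, for a bounded net of tensors `∑ a ⊗ b`, act on the finite-rank
operators in the limit as a scalar of modulus at least `1 / 2`, then the finite-rank operators on
the range of `P` approximately factor through that of `Q`. -/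
theorem approxFactors_of_tendsto {P Q : X →L[ℂ] X} (hP : IsIdempotentElem P) {J : Type*}
    {U : Filter J} [U.NeBot] {l : J → List (approximable X × approximable X)} {B : ℝ}
    (hl : ∀ j, repCost (l j) ≤ B) {c : ℂ} (hc : 1 / 2 ≤ ‖c‖)
    (h : ∀ a ∈ finiteRank X X,
      Filter.Tendsto (fun j => insertSum Subtype.val Q (l j) * a) U (𝓝 (c • a)) ∧
        Filter.Tendsto (fun j => a * insertSum Subtype.val Q (l j)) U (𝓝 (c • a))) :
    ApproxFactors (rg P) (rg Q) (2 * B * ‖P‖ * ‖Q‖) := by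
  intro T hT ε hε
  have hc0 : c ≠ 0 := by
    rintro rfl
    norm_num at hc
  -- `T'` extends `T` to `X` by precomposing with `P`; compressing it to `rg P` gives `T` back.
  set T' : X →L[ℂ] X := ((rg P).subtypeL.comp T).comp (toRange P) with hT'
  obtain ⟨h1, h2⟩ := h T' (comp_comp_mem_finiteRank _ hT _)
  have hcont : Continuous fun S : X →L[ℂ] X => c⁻¹ • compress P P S := by
    unfold compress
    fun_prop
  have hTc : c⁻¹ • compress P P (c • T') = T := by
    ext x
    simp [compress, hT', toRange_coe hP, hc0]
  have h1' := (hcont.tendsto _).comp h1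
  have h2' := (hcont.tendsto _).comp h2
  rw [hTc] at h1' h2'
  have e1 := h1'.eventually (Metric.closedBall_mem_nhds T hε)
  have e2 := h2'.eventually (Metric.closedBall_mem_nhds T hε)
  obtain ⟨j, hj1, hj2⟩ := (e1.and e2).exists
  refine ⟨compressList P Q c⁻¹ (l j), ?_, ?_, ?_⟩
  · refine (repCost_compressList_le _ _ _ _).trans ?_
    have h3 : ‖c⁻¹‖ ≤ 2 := by
      rw [norm_inv]
      exact inv_le_of_inv_le₀ (by norm_num) (by simpa using hc)
    have h4 := repCost_nonneg (l j)
    calc ‖c⁻¹‖ * ‖P‖ * ‖Q‖ * repCost (l j) ≤ 2 * ‖P‖ * ‖Q‖ * B := by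
          gcongr
          exact hl j
      _ = _ := by ring
  · rw [dist_eq_norm'] at hj1
    have h3 : (factorSum (compressList P Q c⁻¹ (l j))).comp T =
        c⁻¹ • compress P P (insertSum Subtype.val Q (l j) * T') := by
      rw [factorSum_compressList]
      ext x
      simp [compress, hT', toRange_coe hP]
    rw [h3]
    exact hj1
  · rw [dist_eq_norm'] at hj2
    have h3 : T.comp (factorSum (compressList P Q c⁻¹ (l j))) =
        c⁻¹ • compress P P (T' * insertSum Subtype.val Q (l j)) := by
      rw [factorSum_compressList]
      ext x
      simp [compress, hT', toRange_coe hP]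
    rw [h3]
    exact hj2

end Compression

/-! ### The dichotomy between the two ranges -/

/-- If `𝓐(X)` is amenable and `P` is a projection, then the finite-rank operators on one of the
ranges of `P` and `1 - P` approximately factor through the other range. -/
theorem IsKAmenable.approxFactors {X : Type u} [NormedAddCommGroup X] [NormedSpace ℂ X]
    [CompleteSpace X] [Nontrivial X] {K : ℝ} (hK : IsKAmenable (approximable X) K)
    {P : X →L[ℂ] X} (hP : IsIdempotentElem P) :
    ApproxFactors (rg P) (rg (1 - P)) (2 * (K + 1) * ‖P‖ * ‖1 - P‖) ∨
      ApproxFactors (rg (1 - P)) (rg P) (2 * (K + 1) * ‖1 - P‖ * ‖P‖) := by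
  let φ : approximable X →ₗ[ℂ] X →L[ℂ] X :=
    { toFun := Subtype.val, map_add' := fun _ _ => rfl, map_smul' := fun _ _ => rfl }
  obtain ⟨J, U, l, hl, hbd, hone, hcomm⟩ :=
    hK.exists_insertSum φ (fun _ _ => rfl) (fun _ => le_rfl)
  obtain ⟨e, he⟩ := exists_ne (0 : X)
  -- The limiting scalar of a net `M j` is read off as the limit of `f (M j e)`, which exists by
  -- compactness of closed discs in `ℂ`.
  obtain ⟨f, hfe⟩ := SeparatingDual.exists_eq_one (R := ℂ) he
  have hlim : ∀ S : X →L[ℂ] X, ∃ c : ℂ,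
      Filter.Tendsto (fun j => f (insertSum φ S (l j) e)) U (𝓝 c) := by
    intro S
    have hball : ∀ j, f (insertSum φ S (l j) e) ∈
        Metric.closedBall (0 : ℂ) (‖f‖ * (‖S‖ * (K + 1) * ‖e‖)) := by
      intro j
      rw [mem_closedBall_zero_iff]
      refine (f.le_opNorm _).trans ?_
      gcongr
      refine (ContinuousLinearMap.le_opNorm _ _).trans ?_
      gcongr
      exact hbd S j
    obtain ⟨c, -, hc⟩ := (isCompact_closedBall _ _).ultrafilter_le_nhds
      (U.map fun j => f (insertSum φ S (l j) e))
      (by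
        rw [Filter.le_principal_iff]
        exact Filter.Eventually.of_forall (f := (U : Filter J)) hball)
    exact ⟨c, hc⟩
  have hcentral : ∀ S : X →L[ℂ] X, ∀ a ∈ finiteRank X X, Filter.Tendsto
      (fun j => a * insertSum φ S (l j) - insertSum φ S (l j) * a) U (𝓝 0) :=
    fun S a ha => hcomm S ⟨a, mem_approximable_of_mem_finiteRank ha⟩
  obtain ⟨c₁, hc₁⟩ := hlim P
  obtain ⟨c₂, hc₂⟩ := hlim (1 - P)
  -- `∑ a P b + ∑ a (1 - P) b = ∑ a b` is an approximate unit; test it on the rank-one operator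
  -- given by `f` and `e`.
  have hsum : c₁ + c₂ = 1 := by
    have h1 : Filter.Tendsto (fun j => insertSum φ 1 (l j) * f.smulRight e) U
        (𝓝 (f.smulRight e)) := hone ⟨f.smulRight e,
      mem_approximable_of_mem_finiteRank (smulRight_mem_finiteRank f e)⟩
    have hev : Continuous fun a : X →L[ℂ] X => f (a e) := by fun_prop
    have h2 := (hev.tendsto _).comp h1
    refine tendsto_nhds_unique (hc₁.add hc₂) ?_
    have h3 : f ((f.smulRight e) e) = 1 := by simp [hfe]
    rw [← h3]
    refine h2.congr fun j => ?_
    rw [← map_add, ← _root_.add_apply, ← insertSum_add, add_sub_cancel]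
    simp [hfe]
  have hnorm : 1 / 2 ≤ ‖c₁‖ ∨ 1 / 2 ≤ ‖c₂‖ := by
    by_contra! hcon
    have h1 := norm_add_le c₁ c₂
    rw [hsum, norm_one] at h1
    linarith
  -- The ranges cross over: a large scalar for `P` makes operators on `rg (1 - P)` factor through
  -- `rg P`, and conversely.
  rcases hnorm with hn | hn
  · exact Or.inr (approxFactors_of_tendsto hP.one_sub hl hn fun a ha =>
      tendsto_mul_of_asymptotically_central (hcentral P) hfe hc₁ ha)
  · exact Or.inl (approxFactors_of_tendsto hP hl hn fun a ha =>
      tendsto_mul_of_asymptotically_central (hcentral (1 - P)) hfe hc₂ ha)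

theorem one_le_norm_of_isIdempotentElem {R : Type*} [NonUnitalNormedRing R] {p : R}
    (hp : IsIdempotentElem p) (h0 : p ≠ 0) : 1 ≤ ‖p‖ := by
  have h := norm_mul_le p p
  rw [hp.eq] at h
  exact le_of_mul_le_mul_right (by simpa using h) (norm_pos_iff.2 h0)

end OperatorIdeals

end

/-! ### The main theorem and its constant -/

theorem mainTheorem9 {X : Type u} [NormedAddCommGroup X] [NormedSpace ℂ X] [CompleteSpace X]
    (K : ℝ) (hK : OperatorIdeals.IsKAmenable (OperatorIdeals.approximable X) K)
    (P : X →L[ℂ] X) (hP : IsIdempotentElem P) (hP0 : P ≠ 0) (hP1 : P ≠ 1) :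
    haveI : CompleteSpace (OperatorIdeals.rg P) := OperatorIdeals.completeSpace_range hP
    haveI : CompleteSpace (OperatorIdeals.rg (1 - P)) :=
      OperatorIdeals.completeSpace_range hP.one_sub
    ∃ κ : ℝ, 0 < κ ∧
      κ ≤ 4 * K ^ 2 * ‖P‖ * ‖1 - P‖ * max (‖P‖ ^ 4) (‖1 - P‖ ^ 4) ∧
      ∀ (γ τ : OperatorIdeals.OperatorIdealNorm.{u}) (c C : ℝ), 0 < c → 0 < C →
        (OperatorIdeals.NormBounds γ τ c C (OperatorIdeals.rg P) (OperatorIdeals.rg (1 - P)) ∨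
          OperatorIdeals.NormBounds γ τ c C
            (OperatorIdeals.rg (1 - P)) (OperatorIdeals.rg P)) →
        (OperatorIdeals.NormBounds γ τ (c * κ ^ (-2 : ℤ)) (C * κ ^ 2)
            (OperatorIdeals.rg P) (OperatorIdeals.rg P) ∨
          OperatorIdeals.NormBounds γ τ (c * κ ^ (-2 : ℤ)) (C * κ ^ 2)
            (OperatorIdeals.rg (1 - P)) (OperatorIdeals.rg (1 - P))) := by
  have : CompleteSpace (OperatorIdeals.rg P) := OperatorIdeals.completeSpace_range hP
  have : CompleteSpace (OperatorIdeals.rg (1 - P)) :=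
    OperatorIdeals.completeSpace_range hP.one_sub
  have hX : Nontrivial X := by
    obtain ⟨x, hx⟩ := DFunLike.ne_iff.1 hP0
    exact ⟨⟨P x, 0, hx⟩⟩
  have hA : Nontrivial (OperatorIdeals.approximable X) := by
    obtain ⟨e, he⟩ := exists_ne (0 : X)
    obtain ⟨f, hfe⟩ := SeparatingDual.exists_eq_one (R := ℂ) he
    refine ⟨⟨⟨f.smulRight e, OperatorIdeals.mem_approximable_of_mem_finiteRank
      (OperatorIdeals.smulRight_mem_finiteRank f e)⟩, 0, fun h => he ?_⟩⟩
    simpa [hfe] using DFunLike.congr_fun (congrArg Subtype.val h) e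
  have hK1 : 1 ≤ K := hK.one_le
  have hp1 : 1 ≤ ‖P‖ := OperatorIdeals.one_le_norm_of_isIdempotentElem hP hP0
  have hq1 : 1 ≤ ‖1 - P‖ := OperatorIdeals.one_le_norm_of_isIdempotentElem hP.one_sub
    (sub_ne_zero.2 hP1.symm)
  -- `κ` is taken to be the largest admissible value `M`. The argument yields the factor `2 (K + 1)
  -- ‖P‖ ‖1 - P‖`, and `K`, `‖P‖`, `‖1 - P‖ ≥ 1` give that this is at most `M ≤ M ^ 2`.
  set M : ℝ := 4 * K ^ 2 * ‖P‖ * ‖1 - P‖ * max (‖P‖ ^ 4) (‖1 - P‖ ^ 4) with hM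
  have hmax : 1 ≤ max (‖P‖ ^ 4) (‖1 - P‖ ^ 4) := le_max_of_le_left (one_le_pow₀ hp1)
  have hpq : 1 ≤ ‖P‖ * ‖1 - P‖ := one_le_mul_of_one_le_of_one_le hp1 hq1
  have hM1 : 2 * (K + 1) * ‖P‖ * ‖1 - P‖ ≤ M := by
    calc 2 * (K + 1) * ‖P‖ * ‖1 - P‖ ≤ 4 * K ^ 2 * ‖P‖ * ‖1 - P‖ := by
          have : 2 * (K + 1) ≤ 4 * K ^ 2 := by nlinarith
          gcongr
      _ ≤ M := le_mul_of_one_le_right (by positivity) hmax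
  have hM2 : 1 ≤ M := by nlinarith
  have hM3 : 2 * (K + 1) * ‖P‖ * ‖1 - P‖ ≤ M ^ 2 := hM1.trans (by nlinarith)
  refine ⟨M, by linarith, le_rfl, fun γ τ c C hc hC h => ?_⟩
  have hz : M ^ (-2 : ℤ) = (M ^ 2)⁻¹ := by
    rw [zpow_neg]
    norm_cast
  rw [hz]
  have hpos : 0 < M ^ 2 := by positivity
  refine hK.approxFactors hP |>.imp (fun hf => ?_) fun hf => ?_
  · exact OperatorIdeals.NormBounds.of_approxFactors hpos (hf.mono hM3) hc hC h
  -- Here the ranges exchange roles, so the two alternatives of the hypothesis are swapped.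
  · refine OperatorIdeals.NormBounds.of_approxFactors hpos (hf.mono ?_) hc hC h.symm
    rwa [mul_right_comm]
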